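/- A *Desargues affine plane* is a set of points and a set of lines with an incidence relation such that: two distinct points lie on exactly one line; for a point $X$ off a line $\ell$ there is exactly one line through $X$ that does not meet $\ell$; there are three non-collinear points; and Desargues' axiom holds (lines are called parallel if they are equal or disjoint): if $a,b,c$ are three distinct lines which are mutually parallel or pass through one point $V$, if $A,A'\in a$, $B,B'\in b$, $C,C'\in c$ (all six points different from $V$ in the concurrent case), and if $AB\parallel A'B'$ and $BC\parallel B'C'$, then $AC\parallel A'C'$. Let $\ell$ be a line, $O\neq I$ points of $\ell$, and $E,F\notin\ell$ auxiliary points. Write $\ell^{X}_{m}$ for the line through $X$ parallel to $m$. For $A,B\in\ell$ put $$A+B=\ell^{Q}_{BE}\cap OI,\quad Q=\ell^{E}_{OI}\cap \ell^{A}_{OE},\qquad\qquad A\cdot B=\ell^{Q}_{BF}\cap OI,\quad Q=\ell^{A}_{IF}\cap OF .$$ Let $-A$ be the point $X\in\ell$ with $A+X=O$, let $A^{-1}$ (for $A\ne O$) be the point $X\in\ell$ with $A\cdot X=I$, and put $A-B=A+(-B)$. For $A,B,C\in\ell$ with $B\neq C$ the *ratio* is the point $r(A,B;C)=(B-C)^{-1}\cdot(A-C)$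 of $\ell$. A *parallel projection* from a line $\ell_1$ to a line $\ell_2$ is a bijection $P_P:\ell_1\to\ell_2$ such that the lines $X\,P_P(X)$ (for $X\in\ell_1$ with $P_P(X)\neq X$) are parallel to each other; if $\ell_1=\ell_2$ it is required to be the restriction of a translation (possibly the identity). Here a translation is a collineation $\tau$ with $\tau(X)\tau(Y)\parallel XY$ for all $X\ne Y$ that is the identity or has no fixed point. **Theorem.** Let $P_P:\ell_1\to\ell_2$ be a parallel projection between two lines of a Desargues affine plane, let $O\neq I$ be points of $\ell_1$, and let $A,B,C\in\ell_1$ with $B\neq C$. Then $$P_P\bigl(r(A,B;C)\bigr)=r\bigl(P_P(A),P_P(B);P_P(C)\bigr),$$ where the ratio on the left is formed on $\ell_1$ with respect to $O,I$ and any auxiliary points $E,F\notin\ell_1$, and the ratio on the right is formed on $\ell_2$ with respect to $P_P(O),P_P(I)$ and any auxiliary points $E',F'\notin\ell_2$. -/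

import Mathlib

namespace DesarguesPlane

/-- Two lines are parallel if they are equal or have no common point. -/
def Par {P L : Type*} [Membership P L] (l m : L) : Prop :=
  l = m ∨ ∀ X : P, X ∈ l → X ∉ m

/-- Affine planes, as incidence structures with point set `P` and line set `L`. -/
class AffinePlane (P L : Type*) [Membership P L] : Prop where
  /-- two distinct points lie on exactly one line -/
  existsUnique_line : ∀ X Y : P, X ≠ Y → ∃! l : L, X ∈ l ∧ Y ∈ l
  /-- through a point off a line there is exactly one line missing that line -/
  playfair : ∀ (X : P) (l : L), X ∉ l → ∃! m : L, X ∈ m ∧ ∀ Y : P, Y ∈ l → Y ∉ m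
  /-- there are three points that do not lie on one line -/
  exists_triangle : ∃ X Y Z : P, X ≠ Y ∧ X ≠ Z ∧ Y ≠ Z ∧ ∀ l : L, ¬ (X ∈ l ∧ Y ∈ l ∧ Z ∈ l)

/-- Desargues affine planes. In the axiom, the triangles `A B C` and `A' B' C'` have their
corresponding vertices on three distinct lines `a`, `b`, `c` that are parallel, or concurrent in a
point `V` different from all vertices; `ab` is the side on which `A` and `B` lie, and so on. -/
class DesarguesAffinePlane (P L : Type*) [Membership P L] : Prop extends AffinePlane P L where
  desargues : ∀ (a b c : L) (A A' B B' C C' : P), a ≠ b → a ≠ c → b ≠ c →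
    A ∈ a → A' ∈ a → B ∈ b → B' ∈ b → C ∈ c → C' ∈ c →
    ((Par a b ∧ Par b c) ∨
      ∃ V : P, V ∈ a ∧ V ∈ b ∧ V ∈ c ∧
        A ≠ V ∧ A' ≠ V ∧ B ≠ V ∧ B' ≠ V ∧ C ≠ V ∧ C' ≠ V) →
    ∀ ab a'b' bc b'c' ac a'c' : L,
      A ∈ ab → B ∈ ab → A' ∈ a'b' → B' ∈ a'b' →
      B ∈ bc → C ∈ bc → B' ∈ b'c' → C' ∈ b'c' →
      A ∈ ac → C ∈ ac → A' ∈ a'c' → C' ∈ a'c' →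
      Par ab a'b' → Par bc b'c' → Par ac a'c'

section Constructions

variable {P : Type*} (L : Type*) [Membership P L] [AffinePlane P L]

/-- A line through `X` and `Y`; for `X ≠ Y` it is unique. -/
theorem exists_line (X Y : P) : ∃ l : L, X ∈ l ∧ Y ∈ l := by
  by_cases h : X = Y
  · subst h
    obtain ⟨U, V, -, hUV, -⟩ := AffinePlane.exists_triangle (P := P) (L := L)
    by_cases hX : X = U
    · obtain ⟨l, hl, -⟩ := AffinePlane.existsUnique_line (L := L) X V (hX ▸ hUV)
      exact ⟨l, hl.1, hl.1⟩
    · obtain ⟨l, hl, -⟩ := AffinePlane.existsUnique_line (L := L) X U hX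
      exact ⟨l, hl.1, hl.1⟩
  · exact (AffinePlane.existsUnique_line X Y h).exists

/-- The line `XY` through the points `X ≠ Y`. -/
noncomputable def line (X Y : P) : L := (exists_line L X Y).choose

theorem left_mem_line (X Y : P) : X ∈ line L X Y := (exists_line L X Y).choose_spec.1

theorem right_mem_line (X Y : P) : Y ∈ line L X Y := (exists_line L X Y).choose_spec.2

variable {L}

theorem exists_parallel (X : P) (l : L) : ∃ m : L, X ∈ m ∧ Par m l := by
  by_cases h : X ∈ l
  · exact ⟨l, h, Or.inl rfl⟩
  · obtain ⟨m, hm, -⟩ := AffinePlane.playfair X l h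
    exact ⟨m, hm.1, Or.inr fun Y h1 h2 => hm.2 Y h2 h1⟩

/-- The line through the point `X` parallel to `l`. -/
noncomputable def parallel (X : P) (l : L) : L := (exists_parallel X l).choose

theorem mem_parallel (X : P) (l : L) : X ∈ parallel X l := (exists_parallel X l).choose_spec.1

theorem parallel_par (X : P) (l : L) : Par (parallel X l) l :=
  (exists_parallel X l).choose_spec.2

theorem nonempty_points (L : Type*) [Membership P L] [AffinePlane P L] : Nonempty P :=
  ⟨(AffinePlane.exists_triangle (P := P) (L := L)).choose⟩

/-- The intersection point of two lines that are not parallel. -/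
noncomputable def meet (l m : L) : P :=
  @Classical.epsilon P (nonempty_points L) fun X => X ∈ l ∧ X ∈ m

theorem meet_mem {l m : L} (h : ¬ Par l m) : meet l m ∈ l ∧ meet l m ∈ m := by
  refine @Classical.epsilon_spec_aux P (nonempty_points L) (fun X => X ∈ l ∧ X ∈ m) ?_
  by_contra h'
  push Not at h'
  exact h (Or.inr h')

variable (L)

/-- The sum `A + B` on the line `OI`, constructed with an auxiliary point `E` off that line:
`Q` is the intersection of the parallel to `OI` through `E` and the parallel to `OE` through `A`;
the sum is the intersection of the parallel to `BE` through `Q` and the line `OI`. -/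
noncomputable def add (O I E A B : P) : P :=
  let Q : P := meet (parallel E (line L O I)) (parallel A (line L O E))
  meet (parallel Q (line L B E)) (line L O I)

/-- The product `A · B` on the line `OI`, constructed with an auxiliary point `F` off that line:
`Q` is the intersection of the parallel to `IF` through `A` and the line `OF`;
the product is the intersection of the parallel to `BF` through `Q` and the line `OI`. -/
noncomputable def mul (O I F A B : P) : P :=
  let Q : P := meet (parallel A (line L I F)) (line L O F)
  meet (parallel Q (line L B F)) (line L O I)

/-- The opposite `-A`: the point `X` of the line `OI` with `A + X = O`. -/
noncomputable def neg (O I E A : P) : P :=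
  @Classical.epsilon P (nonempty_points L) fun X => X ∈ line L O I ∧ add L O I E A X = O

/-- The difference `A - B = A + (-B)`. -/
noncomputable def sub (O I E A B : P) : P := add L O I E A (neg L O I E B)

/-- The inverse `A⁻¹` of a point `A ≠ O`: the point `X` of the line `OI` with `A · X = I`. -/
noncomputable def inv (O I F A : P) : P :=
  @Classical.epsilon P (nonempty_points L) fun X => X ∈ line L O I ∧ mul L O I F A X = I

/-- The ratio `r(A, B; C) = (B - C)⁻¹ · (A - C)` of three points `A`, `B`, `C` with `B ≠ C` of the
line `OI`, where `E` is the auxiliary point for sums and `F` the one for products. -/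
noncomputable def ratio (O I E F A B C : P) : P :=
  mul L O I F (inv L O I F (sub L O I E B C)) (sub L O I E A C)

/-- A dilatation: a collineation that carries each line `XY` to a parallel line. -/
def IsDilatation (δ : Equiv.Perm P) : Prop :=
  (∀ l : L, ∃ m : L, ∀ X : P, X ∈ l ↔ δ X ∈ m) ∧
    ∀ X Y : P, X ≠ Y → Par (line L (δ X) (δ Y)) (line L X Y)

/-- A translation: the identity, or a dilatation without fixed points. -/
def IsTranslation (τ : Equiv.Perm P) : Prop :=
  IsDilatation L τ ∧ (τ = 1 ∨ ∀ X : P, τ X ≠ X)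

variable {L}

/-- `f` restricts to a parallel projection of the line `l₁` onto the line `l₂`: a bijection of `l₁`
onto `l₂` for which all the lines `X f(X)`, where `X ∈ l₁` and `f(X) ≠ X`, are parallel.
If `l₁ = l₂`, these lines all coincide with `l₁` and carry no information; a parallel
projection is then the identity or (the restriction of) a translation. -/
structure IsParallelProjection (l₁ l₂ : L) (f : P → P) : Prop where
  bijOn : Set.BijOn f {X | X ∈ l₁} {X | X ∈ l₂}
  par : ∀ X ∈ l₁, ∀ Y ∈ l₁, f X ≠ X → f Y ≠ Y → Par (line L X (f X)) (line L Y (f Y))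
  self : l₁ = l₂ → ∃ τ : Equiv.Perm P, IsTranslation L τ ∧ ∀ X ∈ l₁, f X = τ X

end Constructions

end DesarguesPlane

/-!
The construction of sums and products is treated relationally: `IsSum l O E A B S` and
`IsProd l O I F A B S` say that the auxiliary point `Q` exists and that the required pairs of points
are parallel. Parallelism of pairs, `SegPar`, holds automatically if one of the pairs consists of
equal points, so that many degenerate positions need no separate treatment. Existence and
uniqueness of sums, products, opposites and inverses are facts of affine incidence geometry alone;
neither associativity nor distributivity is needed. Since a ratio is characterised by sums and
products (`IsRatio`), it suffices that a parallel projection preserves both relations, whatever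
auxiliary points are used.

The results do not depend on the auxiliary points (`IsSum.aux`, `IsProd.aux`): Desargues' axiom is
applied twice, on three parallel lines for sums and on three lines through `O` for products. If the
two auxiliary points are in special position, one passes through a third one. For sums this needs
a third point of the line (`exists_not_mem_not_mem`); without one, `A + A = O` is the only
nontrivial sum and is forced by cancellation.

A projection between two distinct lines `l`, `l'` is a projection in a fixed direction
(`IsParallelProjection.exists_direction`). If the lines are parallel, sums are transferred with an
auxiliary point off both lines (again found from a third point), and products with the
auxiliary points `O'` and its translate along
the line `O O'`. If the lines meet in `O`, products are transferred with an auxiliary point off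
both lines. For sums the same parallelogram computes `A + B` on `l` and `B' + A'` on `l'`
(`IsSum.proj_concurrent_swap`), so the order is reversed. Going around three lines through `O`
reverses it three times while Desargues' axiom makes the composite the identity; hence addition is
commutative (`IsSum.comm`). In general the projection factors through the parallel to `l` through
the image of `O`. On a single line, a translation is a dilatation of the whole plane, preserves
parallelism of pairs, and therefore carries each construction to the construction with
translated auxiliary points.
-/

namespace DesarguesPlane

/-! ### Parallel lines -/

section Affine

variable {P L : Type*} [Membership P L]

theorem Par.refl (l : L) : Par l l := Or.inl rfl

theorem Par.symm {l m : L} (h : Par l m) : Par m l :=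
  h.elim (fun h => Or.inl h.symm) fun h => Or.inr fun X hm hl => h X hl hm

theorem Par.eq_of_mem {l m : L} (h : Par l m) {X : P} (hl : X ∈ l) (hm : X ∈ m) : l = m :=
  h.elim id fun h => absurd hm (h X hl)

/-- A line with one point on `l` and one off `l` is not parallel to `l`. -/
theorem not_par {X Y : P} {k l : L} (hX : X ∈ k) (hY : Y ∈ k) (hXl : X ∈ l) (hYl : Y ∉ l) :
    ¬ Par k l :=
  fun h => hYl (h.eq_of_mem hX hXl ▸ hY)

/-! ### Parallel pairs of points -/

variable (L) in
/-- The pairs `X Y` and `Z W` are parallel: they lie on parallel lines. No points are required to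
be distinct; in an affine plane the relation always holds if `X = Y` or `Z = W`. -/
def SegPar (X Y Z W : P) : Prop :=
  ∃ l m : L, X ∈ l ∧ Y ∈ l ∧ Z ∈ m ∧ W ∈ m ∧ Par l m

variable {X Y Z W U V : P}

theorem SegPar.symm (h : SegPar L X Y Z W) : SegPar L Z W X Y := by
  obtain ⟨l, m, h₁, h₂, h₃, h₄, h⟩ := h
  exact ⟨m, l, h₃, h₄, h₁, h₂, h.symm⟩

theorem SegPar.left (h : SegPar L X Y Z W) : SegPar L Y X Z W := by
  obtain ⟨l, m, h₁, h₂, h₃, h₄, h⟩ := h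
  exact ⟨l, m, h₂, h₁, h₃, h₄, h⟩

theorem SegPar.right (h : SegPar L X Y Z W) : SegPar L X Y W Z := h.symm.left.symm

theorem SegPar.swap (h : SegPar L X Y Z W) : SegPar L Y X W Z := h.left.right

theorem segPar_of_mem {l : L} (hX : X ∈ l) (hY : Y ∈ l) (hZ : Z ∈ l) (hW : W ∈ l) :
    SegPar L X Y Z W :=
  ⟨l, l, hX, hY, hZ, hW, Par.refl l⟩

/-! ### Incidence and parallels in an affine plane -/

variable [AffinePlane P L]

theorem line_unique {X Y : P} {l m : L} (h : X ≠ Y) (hXl : X ∈ l) (hYl : Y ∈ l) (hXm : X ∈ m)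
    (hYm : Y ∈ m) : l = m :=
  (AffinePlane.existsUnique_line X Y h).unique ⟨hXl, hYl⟩ ⟨hXm, hYm⟩

theorem Par.trans {l m n : L} (h₁ : Par l m) (h₂ : Par m n) : Par l n := by
  rcases h₁ with rfl | h₁
  · exact h₂
  rcases h₂ with rfl | h₂
  · exact Or.inr h₁
  by_contra h
  have h' : ∃ X : P, X ∈ l ∧ X ∈ n := by
    by_contra h'
    push Not at h'
    exact h (Or.inr h')
  obtain ⟨X, hl, hn⟩ := h'
  exact h (Or.inl ((AffinePlane.playfair X m (h₁ X hl)).unique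
    ⟨hl, fun Y hm hl => h₁ Y hl hm⟩ ⟨hn, h₂⟩))

theorem line_eq {X Y : P} {l : L} (h : X ≠ Y) (hX : X ∈ l) (hY : Y ∈ l) : line L X Y = l :=
  line_unique h (left_mem_line L X Y) (right_mem_line L X Y) hX hY

theorem eq_parallel {X : P} {l m : L} (hX : X ∈ m) (h : Par m l) : m = parallel X l :=
  (h.trans (parallel_par X l).symm).eq_of_mem hX (mem_parallel X l)

/-- Distinct lines have at most one common point. -/
theorem point_unique {X Y : P} {l m : L} (h : l ≠ m) (hXl : X ∈ l) (hYl : Y ∈ l) (hXm : X ∈ m)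
    (hYm : Y ∈ m) : X = Y := by
  by_contra hXY
  exact h (line_unique hXY hXl hYl hXm hYm)

theorem exists_mem_of_not_par {l m : L} (h : ¬ Par l m) : ∃ X : P, X ∈ l ∧ X ∈ m :=
  ⟨meet l m, meet_mem h⟩

theorem meet_eq {l m : L} (h : ¬ Par l m) {X : P} (hl : X ∈ l) (hm : X ∈ m) : meet l m = X :=
  point_unique (fun e => h (Or.inl e)) (meet_mem h).1 hl (meet_mem h).2 hm

theorem not_mem_of_mem_parallel {X Y : P} {l : L} (hX : X ∉ l) (hY : Y ∈ parallel X l) : Y ∉ l :=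
  fun h => hX ((parallel_par X l).eq_of_mem hY h ▸ mem_parallel X l)

theorem segPar_left_eq (X Z W : P) : SegPar L X X Z W := by
  obtain ⟨m, hZ, hW⟩ := exists_line L Z W
  exact ⟨parallel X m, m, mem_parallel X m, mem_parallel X m, hZ, hW, parallel_par X m⟩

theorem segPar_right_eq (X Y Z : P) : SegPar L X Y Z Z := (segPar_left_eq Z X Y).symm

theorem segPar_refl (X Y : P) : SegPar L X Y X Y := by
  obtain ⟨m, hX, hY⟩ := exists_line L X Y
  exact ⟨m, m, hX, hY, hX, hY, Par.refl m⟩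

theorem SegPar.par (h : SegPar L X Y Z W) (hXY : X ≠ Y) (hZW : Z ≠ W) {l m : L} (hX : X ∈ l)
    (hY : Y ∈ l) (hZ : Z ∈ m) (hW : W ∈ m) : Par l m := by
  obtain ⟨l', m', h₁, h₂, h₃, h₄, h⟩ := h
  rwa [line_unique hXY hX hY h₁ h₂, line_unique hZW hZ hW h₃ h₄]

theorem SegPar.trans (h : SegPar L X Y Z W) (h' : SegPar L Z W U V) (hZW : Z ≠ W) :
    SegPar L X Y U V := by
  obtain ⟨l, m, h₁, h₂, h₃, h₄, h⟩ := h
  obtain ⟨l', m', h₁', h₂', h₃', h₄', h'⟩ := h'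
  obtain rfl := line_unique hZW h₃ h₄ h₁' h₂'
  exact ⟨l, m', h₁, h₂, h₃', h₄', h.trans h'⟩

theorem SegPar.mem (h : SegPar L X Y Z W) (hXY : X ≠ Y) {l m : L} (hX : X ∈ l) (hY : Y ∈ l)
    (hZ : Z ∈ m) (hlm : Par l m) : W ∈ m := by
  obtain ⟨l', m', h₁, h₂, h₃, h₄, h⟩ := h
  obtain rfl := line_unique hXY hX hY h₁ h₂
  exact (h.symm.trans hlm).eq_of_mem h₃ hZ ▸ h₄

theorem SegPar.mem_parallel (h : SegPar L X Y Z W) (hXY : X ≠ Y) {l : L} (hX : X ∈ l)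
    (hY : Y ∈ l) : W ∈ parallel Z l :=
  h.mem hXY hX hY (DesarguesPlane.mem_parallel Z l) (parallel_par Z l).symm

theorem segPar_of_mem_parallel {l : L} (hX : X ∈ l) (hY : Y ∈ l) (hW : W ∈ parallel Z l) :
    SegPar L X Y Z W :=
  ⟨l, _, hX, hY, mem_parallel Z l, hW, (parallel_par Z l).symm⟩

theorem exists_segPar {k l : L} (hX : X ∈ k) (hY : Y ∈ k) (h : ¬ Par k l) (Z : P) :
    ∃ W ∈ l, SegPar L X Y Z W := by
  obtain ⟨W, hW, hWl⟩ := exists_mem_of_not_par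
    (fun h' : Par (parallel Z k) l => h ((parallel_par Z k).symm.trans h'))
  exact ⟨W, hWl, segPar_of_mem_parallel hX hY hW⟩

theorem SegPar.unique (h : SegPar L X Y Z W) (h' : SegPar L X Y Z V) (hXY : X ≠ Y) {k l : L}
    (hX : X ∈ k) (hY : Y ∈ k) (hW : W ∈ l) (hV : V ∈ l) (hkl : ¬ Par k l) : W = V :=
  point_unique (fun e => hkl (by rw [← e]; exact (parallel_par Z k).symm))
    (h.mem_parallel hXY hX hY) (h'.mem_parallel hXY hX hY) hW hV

/-- For three points in general position, the fourth point of a parallelogram. -/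
theorem exists_parallelogram {l : L} {O A E : P} (hO : O ∈ l) (hA : A ∈ l) (hOA : O ≠ A)
    (hE : E ∉ l) : ∃ G, G ∉ l ∧ G ∉ line L O E ∧ SegPar L O E A G ∧ SegPar L O A E G := by
  have h : ¬ Par (line L O E) (parallel E l) := fun h =>
    not_par (left_mem_line L O E) (right_mem_line L O E) hO hE (h.trans (parallel_par E l))
  obtain ⟨G, hG, hG'⟩ := exists_segPar (left_mem_line L O E) (right_mem_line L O E) h A
  have hOE : O ≠ E := fun e => hE (e ▸ hO)
  refine ⟨G, not_mem_of_mem_parallel hE hG, fun hGk => hOA ?_, hG',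
    segPar_of_mem_parallel hO hA hG⟩
  have hGp := hG'.mem_parallel hOE (left_mem_line L O E) (right_mem_line L O E)
  have e := (parallel_par A (line L O E)).eq_of_mem hGp hGk
  exact point_unique (fun e => hE (by rw [← e]; exact right_mem_line L O E)) (left_mem_line L O E)
    (e ▸ DesarguesPlane.mem_parallel A (line L O E)) hO hA

/-- If `l` has three points, then some point lies neither on `l` nor on the
parallel to `l` through `E`. -/
theorem exists_not_mem_not_mem {l : L} {O A X E : P} (hO : O ∈ l) (hA : A ∈ l) (hX : X ∈ l)
    (hOA : O ≠ A) (hXO : X ≠ O) (hXA : X ≠ A) (hE : E ∉ l) :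
    ∃ R, R ∉ l ∧ R ∉ parallel E l := by
  have hOE : O ≠ E := fun e => hE (e ▸ hO)
  obtain ⟨G, hGl, hGk, h₁, h₂⟩ := exists_parallelogram hO hA hOA hE
  have hGm := h₂.mem_parallel hOA hO hA
  have h : ¬ Par (line L X G) (line L O E) := fun h => by
    have hAp : A ∈ line L X G :=
      h₁.right.mem hOE (left_mem_line _ _ _) (right_mem_line _ _ _) (right_mem_line _ _ _) h.symm
    exact hGl (line_unique hXA (left_mem_line L X G) hAp hX hA ▸ right_mem_line L X G)
  obtain ⟨R, hR, hR'⟩ := exists_mem_of_not_par h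
  have hEk := right_mem_line L O E
  have hGn := right_mem_line L X G
  refine ⟨R, fun hRl => hXO ?_, fun hRm => hGk ?_⟩
  · exact (point_unique (fun e => hGl (by rwa [← e])) (left_mem_line L X G) hR hX hRl).trans
      (point_unique (fun e => hE (by rwa [← e])) (left_mem_line L O E) hR' hO hRl).symm
  · have hXm : X ∉ parallel E l := fun h => not_mem_of_mem_parallel hE h hX
    have e₁ : G = R := point_unique (fun e => hXm (by rw [← e]; exact left_mem_line L X G))
      hGn hR hGm hRm
    exact e₁ ▸ hR'

end Affine

/-! ### Sums and products as incidence relations -/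

section Relations

variable {P L : Type*} [Membership P L] [AffinePlane P L]

/-- `S` is the sum of `A` and `B` on the line `l` with origin `O`, constructed with the auxiliary
point `E`. -/
def IsSum (l : L) (O E A B S : P) : Prop :=
  S ∈ l ∧ ∃ Q ∈ parallel E l, SegPar L O E A Q ∧ SegPar L B E S Q

/-- `S` is the product of `A` and `B` on the line `l` with origin `O` and unit point `I`,
constructed with the auxiliary point `F`. -/
def IsProd (l : L) (O I F A B S : P) : Prop :=
  S ∈ l ∧ ∃ Q ∈ line L O F, SegPar L I F A Q ∧ SegPar L B F S Q

variable {l : L} {O I E F A A' B B' S S' : P}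

theorem not_par_parallel (hB : B ∈ l) (hE : E ∉ l) : ¬ Par (line L B E) (parallel E l) :=
  fun h => not_par (left_mem_line L B E) (right_mem_line L B E) hB hE (h.trans (parallel_par E l))

theorem not_par_line (hB : B ∈ l) (hE : E ∉ l) : ¬ Par (line L B E) l :=
  not_par (left_mem_line L B E) (right_mem_line L B E) hB hE

/-- Two transversals through `E` to points of `l` have the same foot if they are parallel. -/
theorem foot_unique (hE : E ∉ l) (hB : B ∈ l) (hB' : B' ∈ l) (h : SegPar L B E B' E) :
    B = B' := by
  have h₁ : SegPar L B E E B' := h.right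
  have h₂ : SegPar L B E E B := (segPar_refl B E).right
  exact h₂.unique h₁ (ne_of_mem_of_not_mem hB hE) (left_mem_line L B E) (right_mem_line L B E)
    hB hB' (not_par_line hB hE)

/-- A parallel to `B E` meets `l` in one point only. -/
theorem foot_unique' (hE : E ∉ l) {Q : P} (hA : A ∈ l) (hA' : A' ∈ l) (hB : B ∈ l)
    (h : SegPar L B E A Q) (h' : SegPar L B E A' Q) : A = A' :=
  h.right.unique h'.right (ne_of_mem_of_not_mem hB hE) (left_mem_line L B E)
    (right_mem_line L B E) hA hA' (not_par_line hB hE)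

theorem IsSum.exists (hO : O ∈ l) (hE : E ∉ l) (A : P) (hB : B ∈ l) :
    ∃ S, IsSum l O E A B S := by
  obtain ⟨Q, hQ, h⟩ := exists_segPar (left_mem_line L O E) (right_mem_line L O E)
    (not_par_parallel hO hE) A
  obtain ⟨S, hS, h'⟩ := exists_segPar (left_mem_line L B E) (right_mem_line L B E)
    (not_par_line hB hE) Q
  exact ⟨S, hS, Q, hQ, h, h'.right⟩

theorem IsSum.unique (hO : O ∈ l) (hE : E ∉ l) (hB : B ∈ l)
    (h : IsSum l O E A B S) (h' : IsSum l O E A B S') : S = S' := by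
  obtain ⟨hS, Q, hQ, h₁, h₂⟩ := h
  obtain ⟨hS', Q', hQ', h₁', h₂'⟩ := h'
  obtain rfl := h₁.unique h₁' (ne_of_mem_of_not_mem hO hE) (left_mem_line L O E)
    (right_mem_line L O E) hQ hQ' (not_par_parallel hO hE)
  exact foot_unique' hE hS hS' hB h₂ h₂'

theorem IsSum.zero_left (hB : B ∈ l) : IsSum l O E O B B :=
  ⟨hB, E, mem_parallel E l, segPar_refl O E, segPar_refl B E⟩

theorem IsSum.zero_right (hO : O ∈ l) (hE : E ∉ l) (hA : A ∈ l) : IsSum l O E A O A := by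
  obtain ⟨Q, hQ, h⟩ := exists_segPar (left_mem_line L O E) (right_mem_line L O E)
    (not_par_parallel hO hE) A
  exact ⟨hA, Q, hQ, h, h⟩

theorem IsSum.cancel_right (hO : O ∈ l) (hE : E ∉ l) (hA : A ∈ l) (hA' : A' ∈ l) (hB : B ∈ l)
    (h : IsSum l O E A B S) (h' : IsSum l O E A' B S) : A = A' := by
  obtain ⟨hS, Q, hQ, h₁, h₂⟩ := h
  obtain ⟨-, Q', hQ', h₁', h₂'⟩ := h'
  obtain rfl := h₂.unique h₂' (ne_of_mem_of_not_mem hB hE) (left_mem_line L B E)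
    (right_mem_line L B E) hQ hQ' (not_par_parallel hB hE)
  exact foot_unique' hE hA hA' hO h₁ h₁'

theorem IsSum.cancel_left (hO : O ∈ l) (hE : E ∉ l) (hB : B ∈ l) (hB' : B' ∈ l)
    (h : IsSum l O E A B S) (h' : IsSum l O E A B' S) : B = B' := by
  obtain ⟨hS, Q, hQ, h₁, h₂⟩ := h
  obtain ⟨-, Q', hQ', h₁', h₂'⟩ := h'
  obtain rfl := h₁.unique h₁' (ne_of_mem_of_not_mem hO hE) (left_mem_line L O E)
    (right_mem_line L O E) hQ hQ' (not_par_parallel hO hE)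
  exact foot_unique hE hB hB' (h₂.trans h₂'.symm
    (ne_of_mem_of_not_mem hS (not_mem_of_mem_parallel hE hQ)))

theorem IsSum.ne_left (hO : O ∈ l) (hE : E ∉ l) (hA : A ∈ l) (hB : B ∈ l) (hBO : B ≠ O)
    (h : IsSum l O E A B S) : S ≠ A := by
  rintro rfl
  exact hBO (h.cancel_left hO hE hB hO (IsSum.zero_right hO hE hA))

theorem IsSum.exists_neg (hO : O ∈ l) (hE : E ∉ l) (A : P) :
    ∃ B ∈ l, IsSum l O E A B O := by
  obtain ⟨Q, hQ, h⟩ := exists_segPar (left_mem_line L O E) (right_mem_line L O E)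
    (not_par_parallel hO hE) A
  obtain ⟨B, hB, h'⟩ := exists_segPar (left_mem_line L O Q) (right_mem_line L O Q)
    (not_par_line hO (not_mem_of_mem_parallel hE hQ)) E
  exact ⟨B, hB, hO, Q, hQ, h, h'.right.symm⟩

theorem add_eq (hO : O ∈ l) (hI : I ∈ l) (hOI : O ≠ I) (hE : E ∉ l) (hB : B ∈ l)
    (h : IsSum l O E A B S) : add L O I E A B = S := by
  obtain ⟨hS, Q, hQ, h₁, h₂⟩ := h
  have hQ' : meet (parallel E l) (parallel A (line L O E)) = Q := by
    refine meet_eq (fun h => not_par_parallel hO hE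
      ((parallel_par A _).symm.trans h.symm)) hQ ?_
    exact h₁.mem_parallel (ne_of_mem_of_not_mem hO hE) (left_mem_line L O E)
      (right_mem_line L O E)
  simp only [add, line_eq hOI hO hI, hQ']
  refine meet_eq (fun h => not_par_line hB hE ((parallel_par Q _).symm.trans h)) ?_ hS
  exact h₂.right.mem_parallel (ne_of_mem_of_not_mem hB hE) (left_mem_line L B E)
      (right_mem_line L B E)

theorem isSum_add (hO : O ∈ l) (hI : I ∈ l) (hOI : O ≠ I) (hE : E ∉ l) (A : P) (hB : B ∈ l) :
    IsSum l O E A B (add L O I E A B) := by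
  obtain ⟨S, hS⟩ := IsSum.exists hO hE A hB
  rwa [add_eq hO hI hOI hE hB hS]

theorem isSum_neg (hO : O ∈ l) (hI : I ∈ l) (hOI : O ≠ I) (hE : E ∉ l) (A : P) :
    neg L O I E A ∈ l ∧ IsSum l O E A (neg L O I E A) O := by
  obtain ⟨B, hB, h⟩ := IsSum.exists_neg hO hE A
  have key := @Classical.epsilon_spec_aux P (nonempty_points L)
    (fun X => X ∈ line L O I ∧ add L O I E A X = O)
    ⟨B, by rwa [line_eq hOI hO hI], add_eq hO hI hOI hE hB h⟩
  change neg L O I E A ∈ line L O I ∧ add L O I E A (neg L O I E A) = O at key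
  rw [line_eq hOI hO hI] at key
  refine ⟨key.1, ?_⟩
  have := isSum_add hO hI hOI hE A key.1
  rwa [key.2] at this

theorem not_par_unit (hO : O ∈ l) (hI : I ∈ l) (hOI : O ≠ I) (hF : F ∉ l) :
    ¬ Par (line L I F) (line L O F) := fun h => by
  have e := h.eq_of_mem (right_mem_line L I F) (right_mem_line L O F)
  have hI' := e ▸ left_mem_line L I F
  exact hF (line_unique hOI (left_mem_line L O F) hI' hO hI ▸ right_mem_line L O F)

/-- The auxiliary point of a product lies off the line if the first factor is not `O`. -/
theorem aux_not_mem (hO : O ∈ l) (hI : I ∈ l) (hF : F ∉ l) {Q : P} (hQ : Q ∈ line L O F)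
    (hA : A ∈ l) (hAO : A ≠ O) (h : SegPar L I F A Q) : Q ∉ l := fun hQl => by
  obtain rfl : Q = O := point_unique (fun e => hF (by rw [← e]; exact right_mem_line L O F))
    hQ (left_mem_line L O F) hQl hO
  exact not_par_line hI hF (h.par (ne_of_mem_of_not_mem hI hF) hAO (left_mem_line L I F)
    (right_mem_line L I F) hA hO)

theorem IsProd.exists (hO : O ∈ l) (hI : I ∈ l) (hOI : O ≠ I) (hF : F ∉ l) (A : P)
    (hB : B ∈ l) : ∃ S, IsProd l O I F A B S := by
  obtain ⟨Q, hQ, h⟩ := exists_segPar (left_mem_line L I F) (right_mem_line L I F)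
    (not_par_unit hO hI hOI hF) A
  obtain ⟨S, hS, h'⟩ := exists_segPar (left_mem_line L B F) (right_mem_line L B F)
    (not_par_line hB hF) Q
  exact ⟨S, hS, Q, hQ, h, h'.right⟩

theorem IsProd.unique (hO : O ∈ l) (hI : I ∈ l) (hOI : O ≠ I) (hF : F ∉ l) (hB : B ∈ l)
    (h : IsProd l O I F A B S) (h' : IsProd l O I F A B S') : S = S' := by
  obtain ⟨hS, Q, hQ, h₁, h₂⟩ := h
  obtain ⟨hS', Q', hQ', h₁', h₂'⟩ := h'
  obtain rfl := h₁.unique h₁' (ne_of_mem_of_not_mem hI hF) (left_mem_line L I F)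
    (right_mem_line L I F) hQ hQ' (not_par_unit hO hI hOI hF)
  exact foot_unique' hF hS hS' hB h₂ h₂'

theorem IsProd.zero_left (hO : O ∈ l) : IsProd l O I F O B O :=
  ⟨hO, O, left_mem_line L O F, segPar_right_eq I F O, segPar_right_eq B F O⟩

theorem IsProd.zero_right (hO : O ∈ l) (hI : I ∈ l) (hOI : O ≠ I) (hF : F ∉ l) :
    IsProd l O I F A O O := by
  obtain ⟨Q, hQ, h⟩ := exists_segPar (left_mem_line L I F) (right_mem_line L I F)
    (not_par_unit hO hI hOI hF) A
  exact ⟨hO, Q, hQ, h, segPar_of_mem (left_mem_line L O F) (right_mem_line L O F)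
    (left_mem_line L O F) hQ⟩

theorem IsProd.cancel_left (hO : O ∈ l) (hI : I ∈ l) (hOI : O ≠ I) (hF : F ∉ l) (hA : A ∈ l)
    (hAO : A ≠ O) (hB : B ∈ l) (hB' : B' ∈ l)
    (h : IsProd l O I F A B S) (h' : IsProd l O I F A B' S) : B = B' := by
  obtain ⟨hS, Q, hQ, h₁, h₂⟩ := h
  obtain ⟨-, Q', hQ', h₁', h₂'⟩ := h'
  obtain rfl := h₁.unique h₁' (ne_of_mem_of_not_mem hI hF) (left_mem_line L I F)
    (right_mem_line L I F) hQ hQ' (not_par_unit hO hI hOI hF)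
  exact foot_unique hF hB hB' (h₂.trans h₂'.symm
    (ne_of_mem_of_not_mem hS (aux_not_mem hO hI hF hQ hA hAO h₁)))

/-- A product of two points different from `O` is different from `O`. -/
theorem IsProd.ne_zero (hO : O ∈ l) (hI : I ∈ l) (hOI : O ≠ I) (hF : F ∉ l) (hA : A ∈ l)
    (hAO : A ≠ O) (hB : B ∈ l) (hBO : B ≠ O) (h : IsProd l O I F A B S) : S ≠ O := by
  rintro rfl
  exact hBO (h.cancel_left hO hI hOI hF hA hAO hB hO (IsProd.zero_right hO hI hOI hF))

theorem IsProd.exists_inv (hO : O ∈ l) (hI : I ∈ l) (hOI : O ≠ I) (hF : F ∉ l) (hA : A ∈ l)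
    (hAO : A ≠ O) : ∃ B ∈ l, IsProd l O I F A B I := by
  obtain ⟨Q, hQ, h⟩ := exists_segPar (left_mem_line L I F) (right_mem_line L I F)
    (not_par_unit hO hI hOI hF) A
  obtain ⟨B, hB, h'⟩ := exists_segPar (left_mem_line L I Q) (right_mem_line L I Q)
    (not_par_line hI (aux_not_mem hO hI hF hQ hA hAO h)) F
  exact ⟨B, hB, hI, Q, hQ, h, h'.right.symm⟩

theorem mul_eq (hO : O ∈ l) (hI : I ∈ l) (hOI : O ≠ I) (hF : F ∉ l) (hB : B ∈ l)
    (h : IsProd l O I F A B S) : mul L O I F A B = S := by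
  obtain ⟨hS, Q, hQ, h₁, h₂⟩ := h
  have hQ' : meet (parallel A (line L I F)) (line L O F) = Q := by
    refine meet_eq (fun h => not_par_unit hO hI hOI hF ((parallel_par A _).symm.trans h)) ?_ hQ
    exact h₁.mem_parallel (ne_of_mem_of_not_mem hI hF) (left_mem_line L I F)
      (right_mem_line L I F)
  simp only [mul, line_eq hOI hO hI, hQ']
  refine meet_eq (fun h => not_par_line hB hF ((parallel_par Q _).symm.trans h)) ?_ hS
  exact h₂.right.mem_parallel (ne_of_mem_of_not_mem hB hF) (left_mem_line L B F)
      (right_mem_line L B F)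

theorem isProd_mul (hO : O ∈ l) (hI : I ∈ l) (hOI : O ≠ I) (hF : F ∉ l) (A : P) (hB : B ∈ l) :
    IsProd l O I F A B (mul L O I F A B) := by
  obtain ⟨S, hS⟩ := IsProd.exists hO hI hOI hF A hB
  rwa [mul_eq hO hI hOI hF hB hS]

theorem isProd_inv (hO : O ∈ l) (hI : I ∈ l) (hOI : O ≠ I) (hF : F ∉ l) (hA : A ∈ l)
    (hAO : A ≠ O) : inv L O I F A ∈ l ∧ IsProd l O I F A (inv L O I F A) I := by
  obtain ⟨B, hB, h⟩ := IsProd.exists_inv hO hI hOI hF hA hAO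
  have key := @Classical.epsilon_spec_aux P (nonempty_points L)
    (fun X => X ∈ line L O I ∧ mul L O I F A X = I)
    ⟨B, by rwa [line_eq hOI hO hI], mul_eq hO hI hOI hF hB h⟩
  change inv L O I F A ∈ line L O I ∧ mul L O I F A (inv L O I F A) = I at key
  rw [line_eq hOI hO hI] at key
  refine ⟨key.1, ?_⟩
  have := isProd_mul hO hI hOI hF A key.1
  rwa [key.2] at this

/-- `R` is a ratio of `A`, `B`, `C`: here `N`, `U`, `V`, `W` are `-C`, `B - C`, `A - C` and
`(B - C)⁻¹`. -/
def IsRatio (l : L) (O I E F A B C R : P) : Prop :=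
  ∃ N ∈ l, IsSum l O E C N O ∧ ∃ U ∈ l, U ≠ O ∧ IsSum l O E B N U ∧ ∃ V ∈ l, IsSum l O E A N V ∧
    ∃ W ∈ l, IsProd l O I F U W I ∧ IsProd l O I F W V R

theorem isRatio_ratio (hO : O ∈ l) (hI : I ∈ l) (hOI : O ≠ I) (hE : E ∉ l) (hF : F ∉ l) {C : P}
    (hB : B ∈ l) (hC : C ∈ l) (hBC : B ≠ C) :
    IsRatio l O I E F A B C (ratio L O I E F A B C) := by
  obtain ⟨hN, h⟩ := isSum_neg hO hI hOI hE C
  have hU := isSum_add hO hI hOI hE B hN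
  have hV := isSum_add hO hI hOI hE A hN
  have hUO : add L O I E B (neg L O I E C) ≠ O := fun e => by
    rw [e] at hU
    exact hBC (hU.cancel_right hO hE hB hC hN h)
  obtain ⟨hW, hW'⟩ := isProd_inv hO hI hOI hF hU.1 hUO
  exact ⟨_, hN, h, _, hU.1, hUO, hU, _, hV.1, hV, _, hW, hW', isProd_mul hO hI hOI hF _ hV.1⟩

theorem IsRatio.unique (hO : O ∈ l) (hI : I ∈ l) (hOI : O ≠ I) (hE : E ∉ l) (hF : F ∉ l)
    {C R R' : P} (h : IsRatio l O I E F A B C R) (h' : IsRatio l O I E F A B C R') : R = R' := by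
  obtain ⟨N, hN, h₁, U, hU, hUO, h₂, V, hV, h₃, W, hW, h₄, h₅⟩ := h
  obtain ⟨N', hN', h₁', U', hU', hUO', h₂', V', hV', h₃', W', hW', h₄', h₅'⟩ := h'
  obtain rfl := h₁.cancel_left hO hE hN hN' h₁'
  obtain rfl := h₂.unique hO hE hN h₂'
  obtain rfl := h₃.unique hO hE hN h₃'
  obtain rfl := h₄.cancel_left hO hI hOI hF hU hUO hW hW' h₄'
  exact h₅.unique hO hI hOI hF hV h₅'

end Relations

section Desargues

variable {P L : Type*} [Membership P L] [DesarguesAffinePlane P L]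

/-! ### Desargues' axiom for parallel pairs -/

theorem desargues_par {a b c : L} {A A' B B' C C' : P} (hab : a ≠ b) (hac : a ≠ c) (hbc : b ≠ c)
    (hpab : Par a b) (hpbc : Par b c) (hA : A ∈ a) (hA' : A' ∈ a) (hB : B ∈ b) (hB' : B' ∈ b)
    (hC : C ∈ c) (hC' : C' ∈ c) (h₁ : SegPar L A B A' B') (h₂ : SegPar L B C B' C') :
    SegPar L A C A' C' := by
  obtain ⟨k, k', i₁, i₂, i₃, i₄, hk⟩ := h₁
  obtain ⟨n, n', j₁, j₂, j₃, j₄, hn⟩ := h₂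
  exact ⟨_, _, left_mem_line L A C, right_mem_line L A C, left_mem_line L A' C',
    right_mem_line L A' C', DesarguesAffinePlane.desargues a b c A A' B B' C C' hab hac hbc hA hA'
      hB hB' hC hC' (Or.inl ⟨hpab, hpbc⟩) _ _ _ _ _ _ i₁ i₂ i₃ i₄ j₁ j₂ j₃ j₄
      (left_mem_line L A C) (right_mem_line L A C) (left_mem_line L A' C')
      (right_mem_line L A' C') hk hn⟩

theorem desargues_concurrent {a b c : L} {V A A' B B' C C' : P} (hab : a ≠ b) (hac : a ≠ c)
    (hbc : b ≠ c) (hVa : V ∈ a) (hVb : V ∈ b) (hVc : V ∈ c) (hA : A ∈ a) (hA' : A' ∈ a)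
    (hB : B ∈ b) (hB' : B' ∈ b) (hC : C ∈ c) (hC' : C' ∈ c) (hAV : A ≠ V) (hAV' : A' ≠ V)
    (hBV : B ≠ V) (hBV' : B' ≠ V) (hCV : C ≠ V) (hCV' : C' ≠ V)
    (h₁ : SegPar L A B A' B') (h₂ : SegPar L B C B' C') : SegPar L A C A' C' := by
  obtain ⟨k, k', i₁, i₂, i₃, i₄, hk⟩ := h₁
  obtain ⟨n, n', j₁, j₂, j₃, j₄, hn⟩ := h₂
  exact ⟨_, _, left_mem_line L A C, right_mem_line L A C, left_mem_line L A' C',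
    right_mem_line L A' C', DesarguesAffinePlane.desargues a b c A A' B B' C C' hab hac hbc hA hA'
      hB hB' hC hC' (Or.inr ⟨V, hVa, hVb, hVc, hAV, hAV', hBV, hBV', hCV, hCV'⟩)
      _ _ _ _ _ _ i₁ i₂ i₃ i₄ j₁ j₂ j₃ j₄ (left_mem_line L A C) (right_mem_line L A C)
      (left_mem_line L A' C') (right_mem_line L A' C') hk hn⟩

variable {l : L} {O I E E' F F' A B S : P}

/-! ### Independence of the auxiliary points -/

/-- Desargues' axiom on `l` and its parallels through `E` and `E'`, applied first to the vertices
`E`, `O`, `E'` and then to `B`, `E`, `E'`. -/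
theorem IsSum.aux_of_not_mem_parallel (hO : O ∈ l) (hA : A ∈ l) (hB : B ∈ l) (hE : E ∉ l)
    (hE' : E' ∉ l) (hEE' : E' ∉ parallel E l) (h : IsSum l O E A B S) : IsSum l O E' A B S := by
  obtain ⟨hS, Q, hQ, h₁, h₂⟩ := h
  obtain ⟨Q', hQ', h₃⟩ := exists_segPar (left_mem_line L O E') (right_mem_line L O E')
    (not_par_parallel hO hE') A
  have hml : parallel E l ≠ l := fun e => hE (by rw [← e]; exact mem_parallel E l)
  have hml' : l ≠ parallel E' l := fun e => hE' (by rw [e]; exact mem_parallel E' l)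
  have hmm' : parallel E l ≠ parallel E' l := fun e => hEE' (by rw [e]; exact mem_parallel E' l)
  have hmE := mem_parallel E l
  have hmE' := mem_parallel E' l
  have k := desargues_par hml hmm' hml' (parallel_par E l) (parallel_par E' l).symm hmE hQ hO hA
    hmE' hQ' h₁.swap h₃
  exact ⟨hS, Q', hQ', h₃, desargues_par hml.symm hml' hmm' (parallel_par E l).symm
    ((parallel_par E l).trans (parallel_par E' l).symm) hB hS hmE hQ hmE' hQ' h₂ k⟩

/-- The sum does not depend on the auxiliary point. -/
theorem IsSum.aux (hO : O ∈ l) (hA : A ∈ l) (hB : B ∈ l) (hE : E ∉ l) (hE' : E' ∉ l)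
    (h : IsSum l O E A B S) : IsSum l O E' A B S := by
  by_cases hEE' : E' ∈ parallel E l
  swap
  · exact h.aux_of_not_mem_parallel hO hA hB hE hE' hEE'
  by_cases hAO : A = O
  · subst hAO
    obtain rfl := h.unique hO hE hB (IsSum.zero_left hB)
    exact IsSum.zero_left hB
  by_cases hBO : B = O
  · subst hBO
    obtain rfl := h.unique hO hE hB (IsSum.zero_right hO hE hA)
    exact IsSum.zero_right hO hE' hA
  obtain ⟨S', h'⟩ := IsSum.exists hO hE' A hB
  -- A third point of `l` gives an auxiliary point off both `l` and its parallel through `E` and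
  -- `E'`; the two candidate sums supply such a third point unless both are `O`.
  have key : ∀ X ∈ l, X ≠ O → X ≠ A → IsSum l O E' A B S := fun X hX hXO hXA => by
    obtain ⟨R, hR, hRE⟩ := exists_not_mem_not_mem hO hA hX (Ne.symm hAO) hXO hXA hE
    refine (h.aux_of_not_mem_parallel hO hA hB hE hR hRE).aux_of_not_mem_parallel hO hA hB hR hE'
      fun hER => hRE ?_
    rw [(parallel_par E l).trans (parallel_par R l).symm |>.eq_of_mem hEE' hER]
    exact mem_parallel R l
  by_cases hSO : S = O
  · by_cases hSO' : S' = O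
    · rw [hSO]
      rwa [hSO'] at h'
    · exact key S' h'.1 hSO' (h'.ne_left hO hE' hA hB hBO)
  · exact key S h.1 hSO (h.ne_left hO hE hA hB hBO)

/-- Projection between two lines through the origin, with an auxiliary point off both lines: the
same point `Q` of the line `O F` serves in both constructions. -/
theorem IsProd.proj_concurrent_of_not_mem {l' : L} {I' A' B' S' : P} (hll' : l ≠ l') (hO : O ∈ l)
    (hO' : O ∈ l') (hI : I ∈ l) (hI' : I' ∈ l') (hA : A ∈ l) (hA' : A' ∈ l') (hB : B ∈ l)
    (hB' : B' ∈ l') (hS' : S' ∈ l') (hIne : I ≠ O) (hIne' : I' ≠ O) (hAO : A ≠ O) (hAO' : A' ≠ O)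
    (hBO : B ≠ O) (hBO' : B' ≠ O) (hSO' : S' ≠ O) (hF : F ∉ l) (hF' : F ∉ l')
    (hIA : SegPar L I I' A A') (hBS : SegPar L B B' S S')
    (h : IsProd l O I F A B S) : IsProd l' O I' F A' B' S' := by
  have hSO := h.ne_zero hO hI hIne.symm hF hA hAO hB hBO
  obtain ⟨hS, Q, hQ, h₁, h₂⟩ := h
  have hQO : Q ≠ O := fun e => aux_not_mem hO hI hF hQ hA hAO h₁ (e ▸ hO)
  have hFO : F ≠ O := fun e => hF (e ▸ hO)
  have hk : line L O F ≠ l := fun e => hF (by rw [← e]; exact right_mem_line L O F)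
  have hk' : line L O F ≠ l' := fun e => hF' (by rw [← e]; exact right_mem_line L O F)
  have hOk := left_mem_line L O F
  have hFk := right_mem_line L O F
  exact ⟨hS', Q, hQ, desargues_concurrent hll'.symm hk'.symm hk.symm hO' hO hOk hI' hA' hI hA hFk
      hQ hIne' hAO' hIne hAO hFO hQO hIA.swap h₁,
    desargues_concurrent hll'.symm hk'.symm hk.symm hO' hO hOk hB' hS' hB hS hFk
      hQ hBO' hSO' hBO hSO hFO hQO hBS.swap h₂⟩

/-- Desargues' axiom on `l`, `O F` and `O F'`, applied first to the vertices `F`, `I`, `F'` and then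
to `B`, `F`, `F'`. -/
theorem IsProd.aux_of_not_mem_line (hO : O ∈ l) (hI : I ∈ l) (hOI : O ≠ I) (hA : A ∈ l)
    (hB : B ∈ l) (hAO : A ≠ O) (hBO : B ≠ O) (hF : F ∉ l) (hF' : F' ∉ l)
    (hFF' : F' ∉ line L O F) (h : IsProd l O I F A B S) : IsProd l O I F' A B S := by
  have hSO := h.ne_zero hO hI hOI hF hA hAO hB hBO
  obtain ⟨hS, Q, hQ, h₁, h₂⟩ := h
  obtain ⟨Q', hQ', h₃⟩ := exists_segPar (left_mem_line L I F') (right_mem_line L I F')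
    (not_par_unit hO hI hOI hF') A
  have hQO : Q ≠ O := fun e => aux_not_mem hO hI hF hQ hA hAO h₁ (e ▸ hO)
  have hQO' : Q' ≠ O := fun e => aux_not_mem hO hI hF' hQ' hA hAO h₃ (e ▸ hO)
  have hFO : F ≠ O := fun e => hF (e ▸ hO)
  have hFO' : F' ≠ O := fun e => hF' (e ▸ hO)
  have hOk := left_mem_line L O F
  have hFk := right_mem_line L O F
  have hOk' := left_mem_line L O F'
  have hFk' := right_mem_line L O F'
  have hkl : line L O F ≠ l := fun e => hF (by rw [← e]; exact hFk)
  have hkl' : l ≠ line L O F' := fun e => hF' (by rw [e]; exact hFk')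
  have hkk' : line L O F ≠ line L O F' := fun e => hFF' (by rw [e]; exact hFk')
  have k := desargues_concurrent hkl hkk' hkl' hOk hO hOk' hFk hQ hI hA hFk' hQ' hFO hQO
    hOI.symm hAO hFO' hQO' h₁.swap h₃
  exact ⟨hS, Q', hQ', h₃, desargues_concurrent hkl.symm hkl' hkk' hO hOk hOk' hB hS hFk hQ
    hFk' hQ' hBO hSO hFO hQO hFO' hQO' h₂ k⟩

/-- The product does not depend on the auxiliary point. -/
theorem IsProd.aux (hO : O ∈ l) (hI : I ∈ l) (hOI : O ≠ I) (hA : A ∈ l) (hB : B ∈ l)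
    (hF : F ∉ l) (hF' : F' ∉ l) (h : IsProd l O I F A B S) : IsProd l O I F' A B S := by
  by_cases hAO : A = O
  · subst hAO
    obtain rfl := h.unique hO hI hOI hF hB (IsProd.zero_left hO)
    exact IsProd.zero_left hO
  by_cases hBO : B = O
  · subst hBO
    obtain rfl := h.unique hO hI hOI hF hB (IsProd.zero_right hO hI hOI hF)
    exact IsProd.zero_right hO hI hOI hF'
  by_cases hFF' : F' ∈ line L O F
  swap
  · exact h.aux_of_not_mem_line hO hI hOI hA hB hAO hBO hF hF' hFF'
  -- If `F'` lies on `O F`, pass through an auxiliary point `G` off `l` and `O F`.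
  obtain ⟨G, hG, hGF, -, -⟩ := exists_parallelogram hO hI hOI hF
  refine (h.aux_of_not_mem_line hO hI hOI hA hB hAO hBO hF hG hGF).aux_of_not_mem_line hO hI hOI
    hA hB hAO hBO hG hF' fun hFG => hGF ?_
  rw [line_unique (ne_of_mem_of_not_mem hO hF') (left_mem_line L O F) hFF' (left_mem_line L O G)
    hFG]
  exact right_mem_line L O G

end Desargues

section Projections

/-! ### Projections in a direction

The projection of `X` to a line in the direction of a line `k` is the point of that line
on `parallel X k`. -/

section Affine

variable {P L : Type*} [Membership P L] [AffinePlane P L]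

variable {k l l' : L} {X X' X'' Y Y' : P}

theorem segPar_of_parallel (hX : X' ∈ parallel X k) (hY : Y' ∈ parallel Y k) :
    SegPar L X X' Y Y' :=
  ⟨_, _, mem_parallel X k, hX, mem_parallel Y k, hY,
    (parallel_par X k).trans (parallel_par Y k).symm⟩

theorem not_par_parallel_left (h : ¬ Par k l) : ¬ Par (parallel X k) l :=
  fun h' => h ((parallel_par X k).symm.trans h')

theorem proj_unique (h : ¬ Par k l') (hX' : X' ∈ l') (hX'' : X'' ∈ l') (h₁ : X' ∈ parallel X k)
    (h₂ : X'' ∈ parallel X k) : X' = X'' :=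
  point_unique (fun e => not_par_parallel_left h (Or.inl e)) h₁ h₂ hX' hX''

theorem exists_proj (h : ¬ Par k l') (X : P) : ∃ X' ∈ l', X' ∈ parallel X k := by
  obtain ⟨X', h₁, h₂⟩ := exists_mem_of_not_par (not_par_parallel_left (X := X) h)
  exact ⟨X', h₂, h₁⟩

theorem parallel_eq_of_mem (h : X' ∈ parallel X k) : parallel X k = parallel X' k :=
  eq_parallel h (parallel_par X k)

theorem mem_parallel_comm (h : X' ∈ parallel X k) : X ∈ parallel X' k :=
  parallel_eq_of_mem h ▸ mem_parallel X k

theorem proj_ne (h : ¬ Par k l) (hX : X ∈ l) (hY : Y ∈ l) (hXY : X ≠ Y) (hX' : X' ∈ parallel X k)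
    (hY' : Y' ∈ parallel Y k) : X' ≠ Y' := by
  rintro rfl
  exact hXY (proj_unique h hX hY (mem_parallel_comm hX') (mem_parallel_comm hY'))

end Affine

variable {P L : Type*} [Membership P L] [DesarguesAffinePlane P L]

variable {k l l' : L} {O O' I I' E E' F F' A A' B B' S S' X X' Y Y' : P}

/-! ### Sums under projections -/

/-- Between parallel lines, an auxiliary point off both lines gives the same point `Q` in both
constructions. -/
theorem IsSum.proj_par_of_not_mem (hll' : l ≠ l') (hpar : Par l l')
    (hO : O ∈ l) (hA : A ∈ l) (hB : B ∈ l)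
    (hO' : O' ∈ l') (hA' : A' ∈ l') (hB' : B' ∈ l') (hS' : S' ∈ l')
    (hOA : SegPar L O O' A A') (hBS : SegPar L B B' S S')
    (hE : E ∉ l) (hE' : E ∉ l') (h : IsSum l O E A B S) : IsSum l' O' E A' B' S' := by
  obtain ⟨hS, Q, hQ, h₁, h₂⟩ := h
  have hml : parallel E l ≠ l := fun e => hE (by rw [← e]; exact mem_parallel E l)
  have hml' : parallel E l ≠ l' := fun e => hE' (by rw [← e]; exact mem_parallel E l)
  have hm := mem_parallel E l
  have hp := parallel_par E l
  have hp' := hp.trans hpar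
  exact ⟨hS', Q, eq_parallel hm hp' ▸ hQ,
    desargues_par hll'.symm hml'.symm hml.symm hpar.symm hp.symm hO' hA' hO hA hm hQ hOA.swap h₁,
    desargues_par hll'.symm hml'.symm hml.symm hpar.symm hp.symm hB' hS' hB hS hm hQ hBS.swap h₂⟩

theorem IsSum.proj_par (hll' : l ≠ l') (hpar : Par l l') (hk : ¬ Par k l)
    (hO : O ∈ l) (hA : A ∈ l) (hB : B ∈ l)
    (hO' : O' ∈ l') (hA' : A' ∈ l') (hB' : B' ∈ l') (hS' : S' ∈ l')
    (hOO : O' ∈ parallel O k) (hAA : A' ∈ parallel A k) (hBB : B' ∈ parallel B k)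
    (hSS : S' ∈ parallel S k)
    (hE : E ∉ l) (hE' : E' ∉ l') (h : IsSum l O E A B S) : IsSum l' O' E' A' B' S' := by
  have hk' : ¬ Par k l' := fun h => hk (h.trans hpar.symm)
  by_cases hAO : A = O
  · subst hAO
    obtain rfl := h.unique hO hE hB (IsSum.zero_left hB)
    obtain rfl := proj_unique hk' hO' hA' hOO hAA
    obtain rfl := proj_unique hk' hB' hS' hBB hSS
    exact IsSum.zero_left hB'
  by_cases hBO : B = O
  · subst hBO
    obtain rfl := h.unique hO hE hB (IsSum.zero_right hO hE hA)
    obtain rfl := proj_unique hk' hO' hB' hOO hBB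
    obtain rfl := proj_unique hk' hA' hS' hAA hSS
    exact IsSum.zero_right hO' hE' hA'
  -- A third point of `l` gives an auxiliary point off both `l` and `l'`; the sums on `l` and `l'`
  -- supply such a third point unless both are the origin.
  have key : ∀ X ∈ l, X ≠ O → X ≠ A → IsSum l' O' E' A' B' S' := fun X hX hXO hXA => by
    have hOl : O' ∉ l := fun h => hll' (hpar.eq_of_mem h hO')
    obtain ⟨R, hR, hRO⟩ := exists_not_mem_not_mem hO hA hX (Ne.symm hAO) hXO hXA hOl
    rw [← eq_parallel hO' hpar.symm] at hRO
    exact ((h.aux hO hA hB hE hR).proj_par_of_not_mem hll' hpar hO hA hB hO' hA' hB' hS'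
      (segPar_of_parallel hOO hAA) (segPar_of_parallel hBB hSS) hR hRO).aux hO' hA' hB' hRO hE'
  obtain ⟨T, hT⟩ := IsSum.exists hO' hE' A' hB'
  by_cases hSO : S = O
  · by_cases hTO : T = O'
    · rw [hSO] at hSS
      rw [hTO] at hT
      rwa [proj_unique hk' hS' hO' hSS hOO]
    · obtain ⟨X, hX, hXT⟩ := exists_proj hk T
      have hTX := mem_parallel_comm hXT
      refine key X hX ?_ ?_
      · rintro rfl
        exact hTO (proj_unique hk' hT.1 hO' hTX hOO)
      · rintro rfl
        refine hT.ne_left hO' hE' hA' hB' ?_ (proj_unique hk' hT.1 hA' hTX hAA)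
        exact proj_ne hk hB hO hBO hBB hOO
  · exact key S h.1 hSO (h.ne_left hO hE hA hB hBO)

/-- Between two lines through the origin, the parallelogram `O A Q B'` serves for the sum
`A + B` with auxiliary point `B'` and for `B' + A'` with auxiliary point `A`. -/
theorem IsSum.proj_concurrent_swap (hll' : l ≠ l') (hk : ¬ Par k l) (hk' : ¬ Par k l')
    (hO : O ∈ l) (hA : A ∈ l) (hB : B ∈ l)
    (hO' : O ∈ l') (hA' : A' ∈ l') (hB' : B' ∈ l') (hS' : S' ∈ l')
    (hAA : A' ∈ parallel A k) (hBB : B' ∈ parallel B k) (hSS : S' ∈ parallel S k)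
    (hE : E ∉ l) (hE' : E' ∉ l') (h : IsSum l O E A B S) : IsSum l' O E' B' A' S' := by
  have hOO := mem_parallel O k
  by_cases hAO : A = O
  · subst hAO
    obtain rfl := h.unique hO hE hB (IsSum.zero_left hB)
    obtain rfl := proj_unique hk' hO' hA' hOO hAA
    obtain rfl := proj_unique hk' hB' hS' hBB hSS
    exact IsSum.zero_right hO' hE' hB'
  by_cases hBO : B = O
  · subst hBO
    obtain rfl := h.unique hO hE hB (IsSum.zero_right hO hE hA)
    obtain rfl := proj_unique hk' hO' hB' hOO hBB
    obtain rfl := proj_unique hk' hA' hS' hAA hSS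
    exact IsSum.zero_left hA'
  have hBO' : B' ≠ O := proj_ne hk hB hO hBO hBB hOO
  have hBl : B' ∉ l := fun h => hBO' (point_unique hll' h hO hB' hO')
  have hAl : A ∉ l' := fun h => hAO (point_unique hll' hA hO h hO')
  obtain ⟨hS, Q, hQ, h₁, h₂⟩ := h.aux hO hA hB hE hBl
  have hQS : Q ∈ parallel S k := h₂.mem (ne_of_mem_of_not_mem hB hBl) (mem_parallel B k) hBB
    (mem_parallel S k) ((parallel_par B k).trans (parallel_par S k).symm)
  refine IsSum.aux hO' hB' hA' hAl hE' ⟨hS', Q, h₁.mem_parallel hBO'.symm hO' hB',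
    segPar_of_mem_parallel hO hA hQ, ⟨parallel A k, parallel S k, hAA, mem_parallel A k, hSS, hQS,
      (parallel_par A k).trans (parallel_par S k).symm⟩⟩

/-- Addition is commutative: project `l` to a second line through `O`, from there to a third one,
and back. Each step reverses the order of the summands, and the composite is the identity by
Desargues' axiom. -/
theorem IsSum.comm (hO : O ∈ l) (hA : A ∈ l) (hB : B ∈ l) (hE : E ∉ l) (h : IsSum l O E A B S) :
    IsSum l O E B A S := by
  by_cases hAO : A = O
  · subst hAO
    obtain rfl := h.unique hO hE hB (IsSum.zero_left hB)
    exact IsSum.zero_right hO hE hB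
  obtain ⟨G, hG, hGE, -, -⟩ := exists_parallelogram hO hA (Ne.symm hAO) hE
  have hOE : O ≠ E := ne_of_mem_of_not_mem hO hE
  have hOG : O ≠ G := ne_of_mem_of_not_mem hO hG
  obtain ⟨l₂, hl₂⟩ : ∃ l₂, l₂ = line L O E := ⟨_, rfl⟩
  obtain ⟨l₃, hl₃⟩ : ∃ l₃, l₃ = line L O G := ⟨_, rfl⟩
  have hO₂ : O ∈ l₂ := hl₂ ▸ left_mem_line L O E
  have hE₂ : E ∈ l₂ := hl₂ ▸ right_mem_line L O E
  have hO₃ : O ∈ l₃ := hl₃ ▸ left_mem_line L O G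
  have hG₃ : G ∈ l₃ := hl₃ ▸ right_mem_line L O G
  rw [← hl₂] at hGE
  have h₁₂ : l ≠ l₂ := fun e => hE (e ▸ hE₂)
  have h₁₃ : l ≠ l₃ := fun e => hG (e ▸ hG₃)
  have h₂₃ : l₂ ≠ l₃ := fun e => hGE (e ▸ hG₃)
  have hA₂ : A ∉ l₂ := fun h => hAO (point_unique h₁₂ hA hO h hO₂)
  have hA₃ : A ∉ l₃ := fun h => hAO (point_unique h₁₃ hA hO h hO₃)
  have hE₃ : E ∉ l₃ := fun h => hOE (point_unique h₂₃ hO₂ hE₂ hO₃ h)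
  have k₁ : ¬ Par (line L A E) l := not_par (left_mem_line _ _ _) (right_mem_line _ _ _) hA hE
  have k₁' : ¬ Par (line L A E) l₂ :=
    not_par (right_mem_line _ _ _) (left_mem_line _ _ _) hE₂ hA₂
  have k₂ : ¬ Par (line L E G) l₂ := not_par (left_mem_line _ _ _) (right_mem_line _ _ _) hE₂ hGE
  have k₂' : ¬ Par (line L E G) l₃ :=
    not_par (right_mem_line _ _ _) (left_mem_line _ _ _) hG₃ hE₃
  have k₃ : ¬ Par (line L A G) l₃ := not_par (right_mem_line _ _ _) (left_mem_line _ _ _) hG₃ hA₃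
  have k₃' : ¬ Par (line L A G) l := not_par (left_mem_line _ _ _) (right_mem_line _ _ _) hA hG
  -- Going from `l` to `l₂`, `l₃` and back returns every point of `l` to itself.
  have key : ∀ X ∈ l, ∃ X₂ ∈ l₂, X₂ ∈ parallel X (line L A E) ∧ ∃ X₃ ∈ l₃,
      X₃ ∈ parallel X₂ (line L E G) ∧ X ∈ parallel X₃ (line L A G) := by
    intro X hX
    obtain ⟨X₂, hX₂, hp₂⟩ := exists_proj k₁' X
    obtain ⟨X₃, hX₃, hp₃⟩ := exists_proj k₂' X₂
    refine ⟨X₂, hX₂, hp₂, X₃, hX₃, hp₃, ?_⟩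
    by_cases hXO : X = O
    · subst hXO
      obtain rfl := proj_unique k₁' hO₂ hX₂ (mem_parallel _ _) hp₂
      obtain rfl := proj_unique k₂' hO₃ hX₃ (mem_parallel _ _) hp₃
      exact mem_parallel _ _
    have hXO₂ : X₂ ≠ O := proj_ne k₁ hX hO hXO hp₂ (mem_parallel _ _)
    have hXO₃ : X₃ ≠ O := proj_ne k₂ hX₂ hO₂ hXO₂ hp₃ (mem_parallel _ _)
    have := desargues_concurrent h₁₂ h₁₃ h₂₃ hO hO₂ hO₃ hA hX hE₂ hX₂ hG₃ hX₃ hAO hXO hOE.symm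
      hXO₂ hOG.symm hXO₃
      (segPar_of_mem_parallel (left_mem_line L A E) (right_mem_line L A E) hp₂)
      (segPar_of_mem_parallel (left_mem_line L E G) (right_mem_line L E G) hp₃)
    exact this.right.mem_parallel (ne_of_mem_of_not_mem hA hG) (left_mem_line L A G)
      (right_mem_line L A G)
  obtain ⟨A₂, a₁, a₂, A₃, a₃, a₄, a₅⟩ := key A hA
  obtain ⟨B₂, b₁, b₂, B₃, b₃, b₄, b₅⟩ := key B hB
  obtain ⟨S₂, s₁, s₂, S₃, s₃, s₄, s₅⟩ := key S h.1
  have r₂ := h.proj_concurrent_swap h₁₂ k₁ k₁' hO hA hB hO₂ a₁ b₁ s₁ a₂ b₂ s₂ hE hA₂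
  have r₃ := r₂.proj_concurrent_swap h₂₃ k₂ k₂' hO₂ b₁ a₁ hO₃ b₃ a₃ s₃ b₄ a₄ s₄ hA₂ hA₃
  exact r₃.proj_concurrent_swap h₁₃.symm k₃ k₃' hO₃ a₃ b₃ hO hA hB h.1 a₅ b₅ s₅ hA₃ hE

/-- Projections between distinct lines preserve sums. -/
theorem IsSum.proj (hll' : l ≠ l') (hk : ¬ Par k l) (hk' : ¬ Par k l')
    (hO : O ∈ l) (hA : A ∈ l) (hB : B ∈ l)
    (hO' : O' ∈ l') (hA' : A' ∈ l') (hB' : B' ∈ l') (hS' : S' ∈ l')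
    (hOO : O' ∈ parallel O k) (hAA : A' ∈ parallel A k) (hBB : B' ∈ parallel B k)
    (hSS : S' ∈ parallel S k)
    (hE : E ∉ l) (hE' : E' ∉ l') (h : IsSum l O E A B S) : IsSum l' O' E' A' B' S' := by
  by_cases hpar : Par l l'
  · exact h.proj_par hll' hpar hk hO hA hB hO' hA' hB' hS' hOO hAA hBB hSS hE hE'
  by_cases hOO' : O' = O
  · subst hOO'
    exact (h.proj_concurrent_swap hll' hk hk' hO hA hB hO' hA' hB' hS' hAA hBB hSS hE hE').comm hO'
      hB' hA' hE'
  -- The projection factors through the parallel to `l` through `O'`.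
  have hm := mem_parallel O' l
  have hp := parallel_par O' l
  have hOm : O ∉ parallel O' l := fun h => by
    rw [hp.eq_of_mem h hO] at hm
    exact hOO' (proj_unique hk hm hO hOO (mem_parallel O k))
  have hlm : l ≠ parallel O' l := fun e => hOm (e ▸ hO)
  have hml' : parallel O' l ≠ l' := fun e => hpar (by rw [← e]; exact hp.symm)
  have hkm : ¬ Par k (parallel O' l) := fun h => hk (h.trans hp)
  obtain ⟨A₁, a₁, a₂⟩ := exists_proj hkm A
  obtain ⟨B₁, b₁, b₂⟩ := exists_proj hkm B
  obtain ⟨S₁, s₁, s₂⟩ := exists_proj hkm S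
  have h₁ := h.proj_par hlm hp.symm hk hO hA hB hm a₁ b₁ s₁ hOO a₂ b₂ s₂ hE hOm
  rw [parallel_eq_of_mem a₂] at hAA
  rw [parallel_eq_of_mem b₂] at hBB
  rw [parallel_eq_of_mem s₂] at hSS
  exact (h₁.proj_concurrent_swap hml' hkm hk' hm a₁ b₁ hO' hA' hB' hS' hAA hBB hSS hOm hE').comm
    hO' hB' hA' hE'

/-! ### Products under projections -/

/-- Two triangles with corresponding vertices on parallel lines: `E E'` is a pair of points of the
line joining `O` to its projection. -/
theorem segPar_proj (hpar : Par l l') (hk : ¬ Par k l) (hO : O ∈ l)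
    (hX : X ∈ l) (hY : Y ∈ l) (hX' : X' ∈ l') (hY' : Y' ∈ l') (hXO : X ≠ O)
    (hE : E ∈ parallel O k) (hE' : E' ∈ parallel O k)
    (hXX : X' ∈ parallel X k) (hYY : Y' ∈ parallel Y k)
    (h : SegPar L X E X' E') : SegPar L Y E Y' E' := by
  by_cases hYO : Y = O
  · subst hYO
    exact segPar_of_mem (mem_parallel Y k) hE hYY hE'
  by_cases hXY : X = Y
  · subst hXY
    rwa [← proj_unique (fun h => hk (h.trans hpar.symm)) hX' hY' hXX hYY]
  have hne : ∀ {U V : P}, U ∈ l → V ∈ l → U ≠ V → parallel U k ≠ parallel V k :=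
    fun {U V} hU hV hUV e => hUV (proj_unique hk hU hV (mem_parallel U k)
      (e ▸ mem_parallel V k))
  have hp : ∀ U V : P, Par (parallel U k) (parallel V k) := fun U V =>
    (parallel_par U k).trans (parallel_par V k).symm
  exact desargues_par (hne hY hX (Ne.symm hXY)) (hne hY hO hYO) (hne hX hO hXO) (hp Y X) (hp X O)
    (mem_parallel Y k) hYY (mem_parallel X k) hXX hE hE' ⟨l, l', hY, hX, hY', hX', hpar⟩ h

/-- For parallel lines `l`, `l'` the auxiliary point `O'` of `l` is carried along the line `O O'`
to the auxiliary point of `l'`. -/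
theorem IsProd.proj_par (hll' : l ≠ l') (hpar : Par l l') (hk : ¬ Par k l)
    (hO : O ∈ l) (hI : I ∈ l) (hOI : O ≠ I) (hA : A ∈ l) (hB : B ∈ l)
    (hO' : O' ∈ l') (hI' : I' ∈ l') (hA' : A' ∈ l') (hB' : B' ∈ l') (hS' : S' ∈ l')
    (hOO : O' ∈ parallel O k) (hII : I' ∈ parallel I k) (hAA : A' ∈ parallel A k)
    (hBB : B' ∈ parallel B k) (hSS : S' ∈ parallel S k)
    (hF : F ∉ l) (hF' : F' ∉ l') (h : IsProd l O I F A B S) : IsProd l' O' I' F' A' B' S' := by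
  have hk' : ¬ Par k l' := fun h => hk (h.trans hpar.symm)
  have hOI' : O' ≠ I' := proj_ne hk hO hI hOI hOO hII
  by_cases hAO : A = O
  · subst hAO
    obtain rfl := h.unique hO hI hOI hF hB (IsProd.zero_left hO)
    obtain rfl := proj_unique hk' hO' hA' hOO hAA
    obtain rfl := proj_unique hk' hO' hS' hOO hSS
    exact IsProd.zero_left hO'
  by_cases hBO : B = O
  · subst hBO
    obtain rfl := h.unique hO hI hOI hF hB (IsProd.zero_right hO hI hOI hF)
    obtain rfl := proj_unique hk' hO' hB' hOO hBB
    obtain rfl := proj_unique hk' hO' hS' hOO hSS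
    exact IsProd.zero_right hO' hI' hOI' hF'
  have hOl : O' ∉ l := fun h => hll' (hpar.eq_of_mem h hO')
  have hIl : I ∉ l' := fun h => hll' (hpar.eq_of_mem hI h)
  have hOp := mem_parallel O k
  have hIp : I ∉ parallel O k := fun h => hOI (proj_unique hk hO hI hOp h)
  obtain ⟨E, hE, h₀⟩ := exists_segPar (left_mem_line L I O') (right_mem_line L I O')
    (not_par (right_mem_line L I O') (left_mem_line L I O') hOO hIp) I'
  have hEO : E ≠ O' := by
    rintro rfl
    exact not_par (right_mem_line L I E) (left_mem_line L I E) hO' hIl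
      (h₀.par (ne_of_mem_of_not_mem hI hOl) hOI'.symm (left_mem_line L I E) (right_mem_line L I E)
        hI' hO')
  have hEl : E ∉ l' := fun h => hEO (proj_unique hk' h hO' hE hOO)
  have hline : line L O O' = parallel O k := line_eq (ne_of_mem_of_not_mem hO hOl) hOp hOO
  have hline' : line L O' E = parallel O k := line_eq hEO.symm hOO hE
  obtain ⟨hS, Q, hQ, h₁, h₂⟩ := h.aux hO hI hOI hA hB hF hOl
  have hQl := aux_not_mem hO hI hOl hQ hA hAO h₁
  obtain ⟨Q', hQ', h₁'⟩ := exists_segPar (left_mem_line L I' E) (right_mem_line L I' E)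
    (not_par_unit hO' hI' hOI' hEl) A'
  have hAQ : SegPar L A Q A' Q' := h₁.symm.trans (h₀.trans h₁' (ne_of_mem_of_not_mem hI' hEl))
    (ne_of_mem_of_not_mem hI hOl)
  have hBE := segPar_proj hpar hk hO hI hB hI' hB' hOI.symm hOO hE hII hBB h₀
  have hSQ := segPar_proj hpar hk hO hA hS hA' hS' hAO (hline ▸ hQ) (hline' ▸ hQ') hAA hSS hAQ
  exact IsProd.aux hO' hI' hOI' hA' hB' hEl hF' ⟨hS', Q', hQ', h₁',
    (hBE.symm.trans h₂ (ne_of_mem_of_not_mem hB hOl)).trans hSQ (ne_of_mem_of_not_mem hS hQl)⟩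

theorem IsProd.proj_concurrent (hll' : l ≠ l') (hk : ¬ Par k l) (hk' : ¬ Par k l')
    (hO : O ∈ l) (hI : I ∈ l) (hOI : O ≠ I) (hA : A ∈ l) (hB : B ∈ l)
    (hO' : O ∈ l') (hI' : I' ∈ l') (hA' : A' ∈ l') (hB' : B' ∈ l') (hS' : S' ∈ l')
    (hII : I' ∈ parallel I k) (hAA : A' ∈ parallel A k)
    (hBB : B' ∈ parallel B k) (hSS : S' ∈ parallel S k)
    (hF : F ∉ l) (hF' : F' ∉ l') (h : IsProd l O I F A B S) : IsProd l' O I' F' A' B' S' := by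
  have hOO := mem_parallel O k
  have hOI' : O ≠ I' := proj_ne hk hO hI hOI hOO hII
  by_cases hAO : A = O
  · subst hAO
    obtain rfl := h.unique hO hI hOI hF hB (IsProd.zero_left hO)
    obtain rfl := proj_unique hk' hO' hA' hOO hAA
    obtain rfl := proj_unique hk' hO' hS' hOO hSS
    exact IsProd.zero_left hO'
  by_cases hBO : B = O
  · subst hBO
    obtain rfl := h.unique hO hI hOI hF hB (IsProd.zero_right hO hI hOI hF)
    obtain rfl := proj_unique hk' hO' hB' hOO hBB
    obtain rfl := proj_unique hk' hO' hS' hOO hSS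
    exact IsProd.zero_right hO' hI' hOI' hF'
  have hIl : I' ∉ l := fun h => hOI' (point_unique hll' hO h hO' hI')
  obtain ⟨G, hG, hG', -, -⟩ := exists_parallelogram hO hI hOI hIl
  rw [line_eq hOI' hO' hI'] at hG'
  have hSO := h.ne_zero hO hI hOI hF hA hAO hB hBO
  exact ((h.aux hO hI hOI hA hB hF hG).proj_concurrent_of_not_mem hll' hO hO' hI hI' hA hA' hB hB'
    hS' hOI.symm hOI'.symm hAO (proj_ne hk hA hO hAO hAA hOO) hBO (proj_ne hk hB hO hBO hBB hOO)
    (proj_ne hk h.1 hO hSO hSS hOO) hG hG' (segPar_of_parallel hII hAA)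
    (segPar_of_parallel hBB hSS)).aux hO' hI' hOI' hA' hB' hG' hF'

/-- Projections between distinct lines preserve products. -/
theorem IsProd.proj (hll' : l ≠ l') (hk : ¬ Par k l) (hk' : ¬ Par k l')
    (hO : O ∈ l) (hI : I ∈ l) (hOI : O ≠ I) (hA : A ∈ l) (hB : B ∈ l)
    (hO' : O' ∈ l') (hI' : I' ∈ l') (hA' : A' ∈ l') (hB' : B' ∈ l') (hS' : S' ∈ l')
    (hOO : O' ∈ parallel O k) (hII : I' ∈ parallel I k) (hAA : A' ∈ parallel A k)
    (hBB : B' ∈ parallel B k) (hSS : S' ∈ parallel S k)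
    (hF : F ∉ l) (hF' : F' ∉ l') (h : IsProd l O I F A B S) : IsProd l' O' I' F' A' B' S' := by
  by_cases hpar : Par l l'
  · exact h.proj_par hll' hpar hk hO hI hOI hA hB hO' hI' hA' hB' hS' hOO hII hAA hBB hSS hF hF'
  by_cases hOO' : O' = O
  · subst hOO'
    exact h.proj_concurrent hll' hk hk' hO hI hOI hA hB hO' hI' hA' hB' hS' hII hAA hBB hSS hF hF'
  -- The projection factors through the parallel to `l` through `O'`.
  have hm := mem_parallel O' l
  have hp := parallel_par O' l
  have hOm : O ∉ parallel O' l := fun h => by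
    rw [hp.eq_of_mem h hO] at hm
    exact hOO' (proj_unique hk hm hO hOO (mem_parallel O k))
  have hlm : l ≠ parallel O' l := fun e => hOm (e ▸ hO)
  have hml' : parallel O' l ≠ l' := fun e => hpar (by rw [← e]; exact hp.symm)
  have hkm : ¬ Par k (parallel O' l) := fun h => hk (h.trans hp)
  obtain ⟨I₁, i₁, i₂⟩ := exists_proj hkm I
  obtain ⟨A₁, a₁, a₂⟩ := exists_proj hkm A
  obtain ⟨B₁, b₁, b₂⟩ := exists_proj hkm B
  obtain ⟨S₁, s₁, s₂⟩ := exists_proj hkm S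
  have h₁ := h.proj_par hlm hp.symm hk hO hI hOI hA hB hm i₁ a₁ b₁ s₁ hOO i₂ a₂ b₂ s₂ hF hOm
  rw [parallel_eq_of_mem i₂] at hII
  rw [parallel_eq_of_mem a₂] at hAA
  rw [parallel_eq_of_mem b₂] at hBB
  rw [parallel_eq_of_mem s₂] at hSS
  exact h₁.proj_concurrent hml' hkm hk' hm i₁ (proj_ne hk hO hI hOI hOO i₂) a₁ b₁ hO' hI' hA' hB'
    hS' hII hAA hBB hSS hOm hF'

end Projections

/-! ### Dilatations -/

section Dilatations

variable {P L : Type*} [Membership P L] [AffinePlane P L] {δ : Equiv.Perm P} {l l' : L}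
  {O I E F A B S X Y Z W : P}

theorem IsDilatation.segPar (hδ : IsDilatation L δ) (X Y : P) : SegPar L (δ X) (δ Y) X Y := by
  by_cases h : X = Y
  · subst h
    exact segPar_left_eq (δ X) X X
  · exact ⟨_, _, left_mem_line _ _ _, right_mem_line _ _ _, left_mem_line _ _ _,
      right_mem_line _ _ _, hδ.2 X Y h⟩

theorem IsDilatation.segPar_map (hδ : IsDilatation L δ) (h : SegPar L X Y Z W) :
    SegPar L (δ X) (δ Y) (δ Z) (δ W) := by
  by_cases hXY : X = Y
  · subst hXY
    exact segPar_left_eq _ _ _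
  by_cases hZW : Z = W
  · subst hZW
    exact segPar_right_eq _ _ _
  exact (hδ.segPar X Y).trans (h.trans (hδ.segPar Z W).symm hZW) hXY

theorem IsDilatation.isSum_map (hδ : IsDilatation L δ) (hl : ∀ X ∈ l, δ X ∈ l') (hO : O ∈ l)
    (hI : I ∈ l) (hOI : O ≠ I) (h : IsSum l O E A B S) :
    IsSum l' (δ O) (δ E) (δ A) (δ B) (δ S) := by
  obtain ⟨hS, Q, hQ, h₁, h₂⟩ := h
  exact ⟨hl S hS, δ Q, (hδ.segPar_map (segPar_of_mem_parallel hO hI hQ)).mem_parallel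
    (δ.injective.ne hOI) (hl O hO) (hl I hI), hδ.segPar_map h₁, hδ.segPar_map h₂⟩

theorem IsDilatation.isProd_map (hδ : IsDilatation L δ) (hl : ∀ X ∈ l, δ X ∈ l') (hO : O ∈ l)
    (hF : F ∉ l) (h : IsProd l O I F A B S) :
    IsProd l' (δ O) (δ I) (δ F) (δ A) (δ B) (δ S) := by
  obtain ⟨hS, Q, hQ, h₁, h₂⟩ := h
  have hOF := segPar_of_mem (left_mem_line L O F) (right_mem_line L O F) (left_mem_line L O F) hQ
  exact ⟨hl S hS, δ Q, (hδ.segPar_map hOF).mem (δ.injective.ne (ne_of_mem_of_not_mem hO hF))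
    (left_mem_line _ _ _) (right_mem_line _ _ _) (left_mem_line _ _ _) (Par.refl _),
    hδ.segPar_map h₁, hδ.segPar_map h₂⟩

end Dilatations

/-! ### Ratios under parallel projections -/

section Ratios

variable {P L : Type*} [Membership P L] {l l' : L} {f : P → P} {O I E F E' F' A B C R : P}

/-- A parallel projection between distinct lines is a projection in a direction different from
those of both lines. -/
theorem IsParallelProjection.exists_direction [AffinePlane P L] (hf : IsParallelProjection l l' f)
    (hll' : l ≠ l') (hO : O ∈ l) (hI : I ∈ l) (hOI : O ≠ I) :
    ∃ k : L, ¬ Par k l ∧ ¬ Par k l' ∧ ∀ X ∈ l, f X ∈ parallel X k := by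
  obtain ⟨Y, hY, hY'⟩ : ∃ Y ∈ l, Y ∉ l' := by
    by_cases h : O ∈ l'
    · exact ⟨I, hI, fun h' => hOI (point_unique hll' hO hI h h')⟩
    · exact ⟨O, hO, h⟩
  have hfY : f Y ∈ l' := hf.bijOn.mapsTo hY
  have hYf : f Y ≠ Y := ne_of_mem_of_not_mem hfY hY'
  have hfl : f Y ∉ l := fun h => by
    -- Otherwise `f Y` is a common point `V` of the lines, and `Y V`, `V (f V)` are `l`, `l'`.
    have hV : f (f Y) ≠ f Y := fun e => hYf (hf.bijOn.injOn h hY e)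
    have hp := hf.par Y hY (f Y) h hYf hV
    rw [line_eq hYf.symm hY h, line_eq hV.symm hfY (hf.bijOn.mapsTo h)] at hp
    exact hll' (hp.eq_of_mem h hfY)
  refine ⟨line L Y (f Y), not_par (left_mem_line _ _ _) (right_mem_line _ _ _) hY hfl,
    not_par (right_mem_line _ _ _) (left_mem_line _ _ _) hfY hY', fun X hX => ?_⟩
  by_cases hXf : f X = X
  · rw [hXf]
    exact mem_parallel _ _
  · rw [← eq_parallel (left_mem_line L X (f X)) (hf.par X hX Y hY hXf hYf)]
    exact right_mem_line _ _ _

variable [DesarguesAffinePlane P L]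

theorem IsParallelProjection.isSum_map (hf : IsParallelProjection l l' f) (hO : O ∈ l)
    (hI : I ∈ l) (hOI : O ≠ I) (hE : E ∉ l) (hE' : E' ∉ l') (hA : A ∈ l) (hB : B ∈ l)
    (h : IsSum l O E A B R) : IsSum l' (f O) E' (f A) (f B) (f R) := by
  have hm : ∀ X ∈ l, f X ∈ l' := fun X hX => hf.bijOn.mapsTo hX
  by_cases hll' : l = l'
  · subst hll'
    obtain ⟨τ, hτ, hfτ⟩ := hf.self rfl
    have hτE : τ E ∉ l := fun h => by
      obtain ⟨X, hX, e⟩ := hf.bijOn.surjOn h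
      exact hE (τ.injective ((hfτ X hX).symm.trans e) ▸ hX)
    have h' := hτ.1.isSum_map (fun X hX => hfτ X hX ▸ hm X hX) hO hI hOI h
    rw [← hfτ O hO, ← hfτ A hA, ← hfτ B hB, ← hfτ R h.1] at h'
    exact h'.aux (hm O hO) (hm A hA) (hm B hB) hτE hE'
  · obtain ⟨k, hk, hk', hfk⟩ := hf.exists_direction hll' hO hI hOI
    exact h.proj hll' hk hk' hO hA hB (hm O hO) (hm A hA) (hm B hB) (hm R h.1) (hfk O hO)
      (hfk A hA) (hfk B hB) (hfk R h.1) hE hE'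

theorem IsParallelProjection.isProd_map (hf : IsParallelProjection l l' f) (hO : O ∈ l)
    (hI : I ∈ l) (hOI : O ≠ I) (hF : F ∉ l) (hF' : F' ∉ l') (hA : A ∈ l) (hB : B ∈ l)
    (h : IsProd l O I F A B R) : IsProd l' (f O) (f I) F' (f A) (f B) (f R) := by
  have hm : ∀ X ∈ l, f X ∈ l' := fun X hX => hf.bijOn.mapsTo hX
  by_cases hll' : l = l'
  · subst hll'
    obtain ⟨τ, hτ, hfτ⟩ := hf.self rfl
    have hτF : τ F ∉ l := fun h => by
      obtain ⟨X, hX, e⟩ := hf.bijOn.surjOn h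
      exact hF (τ.injective ((hfτ X hX).symm.trans e) ▸ hX)
    have h' := hτ.1.isProd_map (fun X hX => hfτ X hX ▸ hm X hX) hO hF h
    rw [← hfτ O hO, ← hfτ I hI, ← hfτ A hA, ← hfτ B hB, ← hfτ R h.1] at h'
    exact h'.aux (hm O hO) (hm I hI) (hf.bijOn.injOn.ne hO hI hOI) (hm A hA) (hm B hB) hτF hF'
  · obtain ⟨k, hk, hk', hfk⟩ := hf.exists_direction hll' hO hI hOI
    exact h.proj hll' hk hk' hO hI hOI hA hB (hm O hO) (hm I hI) (hm A hA) (hm B hB) (hm R h.1)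
      (hfk O hO) (hfk I hI) (hfk A hA) (hfk B hB) (hfk R h.1) hF hF'

theorem IsParallelProjection.isRatio_map (hf : IsParallelProjection l l' f) (hO : O ∈ l)
    (hI : I ∈ l) (hOI : O ≠ I) (hE : E ∉ l) (hF : F ∉ l) (hE' : E' ∉ l') (hF' : F' ∉ l')
    (hA : A ∈ l) (hB : B ∈ l) (hC : C ∈ l) (h : IsRatio l O I E F A B C R) :
    IsRatio l' (f O) (f I) E' F' (f A) (f B) (f C) (f R) := by
  obtain ⟨N, hN, h₁, U, hU, hUO, h₂, V, hV, h₃, W, hW, h₄, h₅⟩ := h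
  have hm : ∀ X ∈ l, f X ∈ l' := fun X hX => hf.bijOn.mapsTo hX
  exact ⟨f N, hm N hN, hf.isSum_map hO hI hOI hE hE' hC hN h₁,
    f U, hm U hU, hf.bijOn.injOn.ne hU hO hUO, hf.isSum_map hO hI hOI hE hE' hB hN h₂,
    f V, hm V hV, hf.isSum_map hO hI hOI hE hE' hA hN h₃,
    f W, hm W hW, hf.isProd_map hO hI hOI hF hF' hU hW h₄, hf.isProd_map hO hI hOI hF hF' hW hV h₅⟩

end Ratios

end DesarguesPlane

theorem mainTheorem1 {P L : Type*} [Membership P L] [DesarguesPlane.DesarguesAffinePlane P L]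
    (l₁ l₂ : L) (f : P → P) (hf : DesarguesPlane.IsParallelProjection l₁ l₂ f)
    (O I : P) (hO : O ∈ l₁) (hI : I ∈ l₁) (hOI : O ≠ I)
    (E F : P) (hE : E ∉ l₁) (hF : F ∉ l₁)
    (E' F' : P) (hE' : E' ∉ l₂) (hF' : F' ∉ l₂)
    (A B C : P) (hA : A ∈ l₁) (hB : B ∈ l₁) (hC : C ∈ l₁) (hBC : B ≠ C) :
    f (DesarguesPlane.ratio L O I E F A B C) =
      DesarguesPlane.ratio L (f O) (f I) E' F' (f A) (f B) (f C) := by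
  have hm : ∀ X ∈ l₁, f X ∈ l₂ := fun X hX => hf.bijOn.mapsTo hX
  have hne : ∀ {X Y : P}, X ∈ l₁ → Y ∈ l₁ → X ≠ Y → f X ≠ f Y :=
    fun hX hY h => hf.bijOn.injOn.ne hX hY h
  exact (hf.isRatio_map hO hI hOI hE hF hE' hF' hA hB hC
    (DesarguesPlane.isRatio_ratio hO hI hOI hE hF hB hC hBC)).unique (hm O hO) (hm I hI)
    (hne hO hI hOI) hE' hF' (DesarguesPlane.isRatio_ratio (hm O hO) (hm I hI) (hne hO hI hOI)
      hE' hF' (hm B hB) (hm C hC) (hne hB hC hBC))
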